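/- Let $\mathbf k$ be a finite field and $R$ a field of characteristic zero. Let $\mathrm{SI}(\mathbf k)$ be the category of finite-dimensional symplectic $\mathbf k$-vector spaces (spaces with a nondegenerate alternating bilinear form) and injective linear maps preserving the forms. An $\mathrm{SI}(\mathbf k)$-module over $R$ is a functor $A$ from $\mathrm{SI}(\mathbf k)$ to $R$-modules; $A_V$ denotes its value at $V$, and $A_n$ its value at $\mathbf k^{2n}$ with the standard symplectic form. Let $H_0^{\mathrm{SI}}$ be the endofunctor of the category of $\mathrm{SI}(\mathbf k)$-modules over $R$ given by $$H_0^{\mathrm{SI}}(A)_V = A_V \big/ \big\langle f_*(A_W) \;:\; f \in \mathrm{Hom}_{\mathrm{SI}(\mathbf k)}(W,V),\ \dim W < \dim V \big\rangle ,$$ and let $H_i^{\mathrm{SI}}$ be its $i$-th left derived functor. Let $A$ be an $\mathrm{SI}(\mathbf k)$-module over $R$ and let $d, r$ be integers such that $H_0^{\mathrm{SI}}(A)_n = 0$ for all $n > d$ and $H_1^{\mathrm{SI}}(A)_n = 0$ for all $n > r$. Then for every $i \geq 2$, $H_i^{\mathrm{SI}}(A)_n = 0$ for all $n > 3^{i-1}\max(r,d)$.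 -/

import Mathlib

open CategoryTheory CategoryTheory.Limits

universe u v

/-- A finite-dimensional symplectic vector space over `k`: a finite-dimensional space with a
nondegenerate alternating bilinear form. These are the objects of the category `SI(k)`. -/
structure SI (k : Type u) [Field k] : Type (u + 1) where
  carrier : Type u
  [addCommGroup : AddCommGroup carrier]
  [module : Module k carrier]
  [finite : Module.Finite k carrier]
  form : LinearMap.BilinForm k carrier
  isAlt : form.IsAlt
  nondegenerate : form.Nondegenerate

namespace SI

attribute [instance] SI.addCommGroup SI.module SI.finite

section

variable {k : Type u} [Field k]

/-- A symplectic embedding: an injective linear map that preserves the symplectic forms. -/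
@[ext]
structure Hom (V W : SI.{u} k) : Type u where
  toLinearMap : V.carrier →ₗ[k] W.carrier
  injective : Function.Injective toLinearMap
  form_map : ∀ x y, W.form (toLinearMap x) (toLinearMap y) = V.form x y

instance : Category.{u} (SI.{u} k) where
  Hom V W := Hom V W
  id V := ⟨LinearMap.id, Function.injective_id, fun _ _ => rfl⟩
  comp f g := ⟨g.toLinearMap ∘ₗ f.toLinearMap, g.injective.comp f.injective,
    fun x y => by simp [g.form_map, f.form_map]⟩

/-- The dimension of a symplectic space. -/
noncomputable def dim (V : SI.{u} k) : ℕ := Module.finrank k V.carrier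

theorem dim_le {V W : SI.{u} k} (f : V ⟶ W) : V.dim ≤ W.dim :=
  LinearMap.finrank_le_finrank_of_injective (Hom.injective f)

end

section

variable (k : Type u) [Field k]

/-- The form `∑ i, (x (i, 0) * y (i, 1) - x (i, 1) * y (i, 0))` on `k ^ (2 * n)`, where the
coordinates are indexed by `Fin n × Fin 2`. -/
def stdForm (n : ℕ) : LinearMap.BilinForm k (Fin n × Fin 2 → k) :=
  LinearMap.mk₂ k (fun x y => ∑ i : Fin n, (x (i, 0) * y (i, 1) - x (i, 1) * y (i, 0)))
    (fun x x' y => by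
      rw [← Finset.sum_add_distrib]
      exact Finset.sum_congr rfl fun i _ => by simp only [Pi.add_apply]; ring)
    (fun c x y => by
      rw [smul_eq_mul, Finset.mul_sum]
      exact Finset.sum_congr rfl fun i _ => by simp only [Pi.smul_apply, smul_eq_mul]; ring)
    (fun x y y' => by
      rw [← Finset.sum_add_distrib]
      exact Finset.sum_congr rfl fun i _ => by simp only [Pi.add_apply]; ring)
    (fun c x y => by
      rw [smul_eq_mul, Finset.mul_sum]
      exact Finset.sum_congr rfl fun i _ => by simp only [Pi.smul_apply, smul_eq_mul]; ring)

theorem stdForm_apply (n : ℕ) (x y : Fin n × Fin 2 → k) :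
    stdForm k n x y = ∑ i : Fin n, (x (i, 0) * y (i, 1) - x (i, 1) * y (i, 0)) := rfl

theorem stdForm_isAlt (n : ℕ) : (stdForm k n).IsAlt := fun x => by
  rw [stdForm_apply]
  exact Finset.sum_eq_zero fun i _ => by ring

theorem stdForm_eq_zero (n : ℕ) (x : Fin n × Fin 2 → k)
    (h : ∀ y, stdForm k n x y = 0) : x = 0 := by
  funext ⟨i, j⟩
  have h0 := h (Pi.single (i, 0) 1)
  have h1 := h (Pi.single (i, 1) 1)
  simp only [stdForm_apply, Pi.single_apply, Prod.mk.injEq] at h0 h1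
  fin_cases j <;> simp_all

theorem stdForm_nondegenerate (n : ℕ) : (stdForm k n).Nondegenerate :=
  (LinearMap.IsRefl.nondegenerate_iff_separatingLeft (stdForm_isAlt k n).isRefl).2
    fun x hx => stdForm_eq_zero k n x hx

/-- The standard symplectic space `k ^ (2 * n)`. -/
def std (n : ℕ) : SI.{u} k where
  carrier := Fin n × Fin 2 → k
  form := stdForm k n
  isAlt := stdForm_isAlt k n
  nondegenerate := stdForm_nondegenerate k n

end

end SI

/-- The category of `SI(k)`-modules over `R`: functors from `SI(k)` to `R`-modules. -/
abbrev SIMod (k : Type u) [Field k] (R : Type v) [CommRing R] :=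
  SI.{u} k ⥤ ModuleCat.{max u v} R

namespace SIMod

section EnoughProjectives

variable (k : Type u) [Field k] (R : Type v) [CommRing R]

/-- The symplectic spaces whose underlying vector space is `k ^ m` for some `m`. Up to isomorphism
they are all objects of `SI(k)`. -/
structure SmallIndex : Type u where
  m : ℕ
  form : LinearMap.BilinForm k (Fin m → k)
  isAlt : form.IsAlt
  nondegenerate : form.Nondegenerate

/-- The symplectic space given by an index. -/
def SmallIndex.toSI (j : SmallIndex.{u} k) : SI.{u} k where
  carrier := Fin j.m → k
  form := j.form
  isAlt := j.isAlt
  nondegenerate := j.nondegenerate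

theorem exists_smallIndex_iso (V : SI.{u} k) : ∃ j : SmallIndex.{u} k, Nonempty (j.toSI ≅ V) := by
  let e : (Fin (Module.finrank k V.carrier) → k) ≃ₗ[k] V.carrier :=
    (Module.finBasis k V.carrier).equivFun.symm
  let B : LinearMap.BilinForm k (Fin (Module.finrank k V.carrier) → k) :=
    V.form.compl₁₂ e.toLinearMap e.toLinearMap
  have hB : ∀ x y, B x y = V.form (e x) (e y) := fun _ _ => rfl
  have hAlt : B.IsAlt := fun x => V.isAlt (e x)
  have hnd : B.Nondegenerate := by
    refine (LinearMap.IsRefl.nondegenerate_iff_separatingLeft hAlt.isRefl).2 fun x hx => ?_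
    have h2 : e x = 0 := V.nondegenerate.1 (e x) fun y => by
      have := hx (e.symm y)
      rwa [hB, e.apply_symm_apply] at this
    simpa using h2
  exact ⟨⟨_, B, hAlt, hnd⟩, ⟨{
    hom := ⟨e.toLinearMap, e.injective, fun _ _ => rfl⟩
    inv := ⟨e.symm.toLinearMap, e.symm.injective, fun x y => by
      change V.form (e (e.symm x)) (e (e.symm y)) = _
      simp⟩
    hom_inv_id := SI.Hom.ext (LinearMap.ext fun x => e.symm_apply_apply x)
    inv_hom_id := SI.Hom.ext (LinearMap.ext fun x => e.apply_symm_apply x) }⟩⟩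

instance enoughProjectives : EnoughProjectives (SIMod.{u, v} k R) where
  presentation A := by
    let L (V : SI.{u} k) := evaluationLeftAdjoint (ModuleCat.{max u v} R) V
    let adj (V : SI.{u} k) := evaluationAdjunctionRight (ModuleCat.{max u v} R) V
    let P (j : SmallIndex.{u} k) : SIMod.{u, v} k R :=
      (L j.toSI).obj (Projective.over (A.obj j.toSI))
    have hP (j) : Projective (P j) := (adj j.toSI).map_projective _ inferInstance
    let p (j) : P j ⟶ A := ((adj j.toSI).homEquiv _ _).symm (Projective.π (A.obj j.toSI))
    have hp (j) : Epi ((p j).app j.toSI) := by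
      have h : ((adj j.toSI).homEquiv _ _) (p j) = Projective.π (A.obj j.toSI) :=
        Equiv.apply_symm_apply _ _
      rw [Adjunction.homEquiv_unit] at h
      have h' : Epi (((adj j.toSI).unit.app _) ≫ (p j).app j.toSI) := by
        change Epi (((adj j.toSI).unit.app _) ≫ ((evaluation _ _).obj j.toSI).map (p j))
        rw [h]
        exact Projective.π_epi _
      exact @epi_of_epi _ _ _ _ _ _ _ h'
    have hproj : Projective (∐ P) := ⟨fun f e _ =>
      ⟨Sigma.desc fun j => Projective.factorThru (Sigma.ι P j ≫ f) e, Sigma.hom_ext _ _ fun j => by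
        rw [Sigma.ι_desc_assoc, Projective.factorThru_comp]⟩⟩
    refine ⟨{ p := ∐ P, f := Sigma.desc p, epi := ?_, projective := hproj }⟩
    have key (V : SI.{u} k) : Epi ((Sigma.desc p).app V) := by
      obtain ⟨j, ⟨i⟩⟩ := exists_smallIndex_iso k V
      have h1 : Epi ((Sigma.desc p).app j.toSI) := by
        have h2 : (Sigma.ι P j).app j.toSI ≫ (Sigma.desc p).app j.toSI = (p j).app j.toSI := by
          rw [← NatTrans.comp_app, Sigma.ι_desc]
        have h3 : Epi ((Sigma.ι P j).app j.toSI ≫ (Sigma.desc p).app j.toSI) := by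
          rw [h2]; exact hp j
        exact @epi_of_epi _ _ _ _ _ _ _ h3
      have h4 : (Sigma.desc p).app V = (∐ P).map i.inv ≫ (Sigma.desc p).app j.toSI ≫ A.map i.hom := by
        rw [← NatTrans.naturality, ← Functor.map_comp_assoc]
        simp
      rw [h4]
      infer_instance
    exact NatTrans.epi_of_epi_app _

end EnoughProjectives

section Homology

variable {k : Type u} [Field k] {R : Type v} [CommRing R]

/-- The submodule of `A_V` spanned by the images of all maps `f_* : A_W → A_V`, where `f : W → V`
is a symplectic embedding and `dim W < dim V`. -/
def lower (A : SIMod.{u, v} k R) (V : SI.{u} k) : Submodule R (A.obj V) :=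
  Submodule.span R {x | ∃ (W : SI.{u} k) (f : W ⟶ V) (a : A.obj W),
    W.dim < V.dim ∧ A.map f a = x}

theorem lower_le_comap (A : SIMod.{u, v} k R) {V V' : SI.{u} k} (g : V ⟶ V') :
    lower A V ≤ (lower A V').comap (A.map g).hom := by
  refine Submodule.span_le.2 ?_
  rintro x ⟨W, f, a, hW, rfl⟩
  refine Submodule.subset_span ⟨W, f ≫ g, a, hW.trans_le (SI.dim_le g), ?_⟩
  simp

theorem lower_le_comap_app {A B : SIMod.{u, v} k R} (φ : A ⟶ B) (V : SI.{u} k) :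
    lower A V ≤ (lower B V).comap (φ.app V).hom := by
  refine Submodule.span_le.2 ?_
  rintro x ⟨W, f, a, hW, rfl⟩
  refine Submodule.subset_span ⟨W, f, φ.app W a, hW, ?_⟩
  exact (NatTrans.naturality_apply φ f a).symm

variable (k R)

/-- The functor `H_0` from `SI(k)`-modules to `SI(k)`-modules: the value of `H_0(A)` at `V` is the
quotient of `A_V` by the span of the images of all `A_W` with `W → V` and `dim W < dim V`. -/
noncomputable def H0 : SIMod.{u, v} k R ⥤ SIMod.{u, v} k R where
  obj A :=
    { obj V := ModuleCat.of R (A.obj V ⧸ lower A V)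
      map g := ModuleCat.ofHom (Submodule.mapQ _ _ (A.map g).hom (lower_le_comap A g))
      map_id V := by
        ext x
        simp
      map_comp f g := by
        ext x
        simp }
  map {A B} φ :=
    { app V := ModuleCat.ofHom (Submodule.mapQ _ _ (φ.app V).hom (lower_le_comap_app φ V))
      naturality V V' g := by
        ext x
        simp [NatTrans.naturality_apply] }
  map_id A := by
    ext V x
    simp
  map_comp φ ψ := by
    ext V x
    simp

instance H0_additive : (H0.{u, v} k R).Additive where
  map_add {A B φ ψ} := by
    refine NatTrans.ext (funext fun V => ModuleCat.hom_ext (Submodule.linearMap_qext _ ?_))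
    ext x
    rfl

/-- `SI`-homology: `H_i` is the `i`-th left derived functor of `H_0`. -/
noncomputable def H (i : ℕ) : SIMod.{u, v} k R ⥤ SIMod.{u, v} k R :=
  (H0.{u, v} k R).leftDerived i

end Homology

/-- The value `A_n` of an `SI(k)`-module `A` at the standard symplectic space `k ^ (2 * n)`. -/
abbrev deg {k : Type u} [Field k] {R : Type v} [CommRing R] (A : SIMod.{u, v} k R) (n : ℕ) :
    ModuleCat.{max u v} R :=
  A.obj (SI.std k n)

end SIMod

/-! Put `N = max r d`. The module `A` is generated in degrees `≤ N`, so it is a quotient of a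
projective module `F` that is free on generators in degrees `≤ N`. As `H_1(A)` and `H_0(F)` vanish
above `N`, so does `H_0` of the kernel `K` of `F → A`; thus `K` is again generated in degrees `≤ N`,
and `H_(i+2)(A)` is controlled by `H_(i+1)(K)`. The gain is that `K` lies in a free module.

Everything rests on `GeneratedInDegree.kernel`: if `P` is generated in degrees `≤ N`, the kernel of
a map from `P` to a free module is generated in degrees `≤ 3 * N`. Covering `K` by a free module,
then the kernel of that cover, and so on, costs a factor 3 per step and gives the bound.

For the kernel lemma take embeddings `U → V' → V` with `dim U = 2N`, `dim V' ≥ 6N` and `dim V' < dim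
V`, and let `G'` and `G` be the stabilisers of `U` in `Aut V'` and `Aut V`. By Maschke's theorem the
kernel at `V` is spanned by translates of `G`-fixed vectors `t`. Witt's theorem moves every
generator of `P_V` into `V'` by an element of `G`, so the `G`-sum of `t` is the `G`-sum of the image
of some `z` in `P_V'` (`GeneratedInDegree.exists_fixerSum_push_eq`). For free modules, pushing to
`V` and summing over `G` is injective on `G'`-fixed vectors (`free_eq_zero_of_fixerSum_eq_zero`), so
the `G'`-sum of `z` already lies in the kernel at `V'`. A nonzero multiple of `t` is therefore a sum
of images from `V'`. -/

namespace LinearPMap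

/-! ### Extending partial isometries of alternating forms -/

variable {k E F : Type*} [Field k] [AddCommGroup E] [Module k E] [AddCommGroup F] [Module k F]

/-- A partially defined linear map that is injective and preserves the given forms. -/
structure IsIsometric (BE : LinearMap.BilinForm k E) (BF : LinearMap.BilinForm k F)
    (σ : E →ₗ.[k] F) : Prop where
  injective : Function.Injective σ
  form_map : ∀ x y, BF (σ x) (σ y) = BE x y

variable {BE : LinearMap.BilinForm k E} {BF : LinearMap.BilinForm k F}

/-- Send `v` to `w`. The pairings with the old domain are prescribed by `hw`, the self-pairings
vanish because both forms alternate, and injectivity holds because `w` is outside the range of `σ`.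
-/
theorem IsIsometric.exists_extend_of_notMem (hE : BE.IsAlt) (hF : BF.IsAlt) {σ : E →ₗ.[k] F}
    (hσ : σ.IsIsometric BE BF) {v : E} (hv : v ∉ σ.domain) {w : F}
    (hw : ∀ s : σ.domain, BF (σ s) w = BE s v) (hw' : ∀ s, σ s ≠ w) :
    ∃ τ : E →ₗ.[k] F, σ ≤ τ ∧ v ∈ τ.domain ∧ τ.IsIsometric BE BF := by
  refine ⟨σ.supSpanSingleton v w hv, LinearPMap.left_le_sup _ _ _,
    Submodule.mem_sup_right (Submodule.mem_span_singleton_self v), ?_, ?_⟩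
  · refine (injective_iff_map_eq_zero (σ.supSpanSingleton v w hv).toFun).2 ?_
    rintro ⟨x, hx⟩ h0
    obtain ⟨s, hs, z, hz, rfl⟩ := Submodule.mem_sup.1 hx
    obtain ⟨c, rfl⟩ := Submodule.mem_span_singleton.1 hz
    have h1 : σ ⟨s, hs⟩ + c • w = 0 := by
      rw [← h0]
      exact (supSpanSingleton_apply_mk σ v w hv s hs c).symm
    by_cases hc : c = 0
    · subst hc
      have h2 : σ ⟨s, hs⟩ = σ 0 := by simpa using h1
      have h3 := congrArg Subtype.val (hσ.injective h2)
      ext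
      simpa using h3
    · refine absurd ?_ (hw' (-c⁻¹ • ⟨s, hs⟩))
      rw [map_smul, eq_neg_of_add_eq_zero_left h1, smul_neg, neg_smul, neg_neg, smul_smul,
        inv_mul_cancel₀ hc, one_smul]
  · rintro ⟨x, hx⟩ ⟨y, hy⟩
    obtain ⟨s, hs, z, hz, rfl⟩ := Submodule.mem_sup.1 hx
    obtain ⟨c, rfl⟩ := Submodule.mem_span_singleton.1 hz
    obtain ⟨s', hs', z', hz', rfl⟩ := Submodule.mem_sup.1 hy
    obtain ⟨c', rfl⟩ := Submodule.mem_span_singleton.1 hz'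
    have e1 := supSpanSingleton_apply_mk σ v w hv s hs c
    have e2 := supSpanSingleton_apply_mk σ v w hv s' hs' c'
    have e3 := hw ⟨s, hs⟩
    have e4 : BF w (σ ⟨s', hs'⟩) = BE v s' := by
      rw [← LinearMap.BilinForm.IsAlt.neg_eq hF, hw, LinearMap.BilinForm.IsAlt.neg_eq hE]
    have e5 := hσ.form_map ⟨s, hs⟩ ⟨s', hs'⟩
    have e6 := hF w
    have e7 := hE v
    simp only [RingHom.id_apply] at e1 e2
    refine (congrArg₂ (fun a b => BF a b) e1 e2).trans ?_
    simp [e3, e4, e5, e6, e7]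

/-- If every isometric extension of `σ` with proper domain can be extended by one more vector,
then `σ` has an everywhere defined isometric extension. -/
theorem IsIsometric.exists_linearMap [FiniteDimensional k E] {σ : E →ₗ.[k] F}
    (hσ : σ.IsIsometric BE BF)
    (h : ∀ τ : E →ₗ.[k] F, σ ≤ τ → τ.IsIsometric BE BF → τ.domain ≠ ⊤ →
      ∃ ρ : E →ₗ.[k] F, τ ≤ ρ ∧ τ.domain ≠ ρ.domain ∧ ρ.IsIsometric BE BF) :
    ∃ f : E →ₗ[k] F, Function.Injective f ∧ (∀ x y, BF (f x) (f y) = BE x y) ∧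
      ∀ s : σ.domain, f s = σ s := by
  have key : ∀ (n : ℕ) (τ : E →ₗ.[k] F), σ ≤ τ → τ.IsIsometric BE BF →
      Module.finrank k E ≤ n + Module.finrank k τ.domain →
      ∃ ρ : E →ₗ.[k] F, σ ≤ ρ ∧ ρ.domain = ⊤ ∧ ρ.IsIsometric BE BF := by
    intro n
    induction n with
    | zero =>
      intro τ h1 h2 h3
      refine ⟨τ, h1, ?_, h2⟩
      exact Submodule.eq_top_of_finrank_eq (le_antisymm (Submodule.finrank_le _) (by omega))
    | succ n ih =>
      intro τ h1 h2 h3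
      by_cases ht : τ.domain = ⊤
      · exact ⟨τ, h1, ht, h2⟩
      · obtain ⟨ρ, h4, h5, h6⟩ := h τ h1 h2 ht
        have := Submodule.finrank_lt_finrank_of_lt (lt_of_le_of_ne h4.1 h5)
        exact ih ρ (h1.trans h4) h6 (by omega)
  obtain ⟨ρ, h1, h2, h3⟩ := key _ σ le_rfl hσ (Nat.le_add_right _ _)
  refine ⟨ρ.toFun ∘ₗ (LinearEquiv.ofTop _ h2).symm.toLinearMap,
    h3.injective.comp (LinearEquiv.ofTop _ h2).symm.injective, fun x y => ?_, fun s => ?_⟩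
  · exact h3.form_map _ _
  · exact (h1.2 (by rfl)).symm

theorem exists_form_eq [FiniteDimensional k F] (hF : BF.Nondegenerate) {σ : E →ₗ.[k] F}
    (hσ : Function.Injective σ) (l : σ.domain →ₗ[k] k) : ∃ w, ∀ s, BF w (σ s) = l s := by
  obtain ⟨g, hg⟩ := LinearMap.exists_leftInverse_of_injective σ.toFun (LinearMap.ker_eq_bot.2 hσ)
  refine ⟨(BF.toDual hF).symm (l ∘ₗ g), fun s => ?_⟩
  rw [← LinearMap.BilinForm.toDual_def hF, LinearEquiv.apply_symm_apply]
  exact congrArg l (LinearMap.congr_fun hg s)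

/-- Nondegeneracy provides a `w` with the right pairings; the only danger is that `w` lies in the
range. If some vector orthogonal to the range lies outside it, adding that vector to `w` repairs
this. Otherwise `w = σ s`, and `v - s` is orthogonal to the domain, which `h` excludes. -/
theorem IsIsometric.exists_extend_of_orthogonal [FiniteDimensional k F] (hE : BE.IsAlt)
    (hF : BF.IsAlt) (hnd : BF.Nondegenerate) {σ : E →ₗ.[k] F} (hσ : σ.IsIsometric BE BF)
    {v : E} (hv : v ∉ σ.domain)
    (h : (∀ w, (∀ s, BF (σ s) w = 0) → ∃ s, σ s = w) →
      ¬ ∃ s : σ.domain, ∀ t : σ.domain, BE t (v - s) = 0) :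
    ∃ τ : E →ₗ.[k] F, σ ≤ τ ∧ v ∈ τ.domain ∧ τ.IsIsometric BE BF := by
  obtain ⟨w, hw⟩ := exists_form_eq hnd hσ.injective (-(BE.flip v ∘ₗ σ.domain.subtype))
  have hw : ∀ s : σ.domain, BF (σ s) w = BE s v := fun s => by
    rw [← LinearMap.BilinForm.IsAlt.neg_eq hF, hw]; simp
  by_cases h1 : ∀ s, σ s ≠ w
  · exact hσ.exists_extend_of_notMem hE hF hv hw h1
  push Not at h1
  obtain ⟨s, hs⟩ := h1
  by_cases h2 : ∀ w, (∀ s, BF (σ s) w = 0) → ∃ s, σ s = w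
  · refine absurd ⟨s, fun t => ?_⟩ (h h2)
    rw [_root_.map_sub, ← hw t, ← hs, hσ.form_map, sub_self]
  · push Not at h2
    obtain ⟨w', h3, h4⟩ := h2
    refine hσ.exists_extend_of_notMem hE hF hv (w := w + w') (fun s => ?_) fun t ht => ?_
    · rw [_root_.map_add, hw, h3, add_zero]
    · refine h4 (t - s) ?_
      rw [LinearPMap.map_sub, ht, hs, add_sub_cancel_left]

/-- **Witt's extension theorem** for alternating forms. -/
theorem IsIsometric.exists_linearMap_of_finrank_le [FiniteDimensional k E] [FiniteDimensional k F]
    (hE : BE.IsAlt) (hE' : BE.Nondegenerate) (hF : BF.IsAlt) (hF' : BF.Nondegenerate)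
    (hEF : Module.finrank k E ≤ Module.finrank k F) {σ : E →ₗ.[k] F} (hσ : σ.IsIsometric BE BF) :
    ∃ f : E →ₗ[k] F, Function.Injective f ∧ (∀ x y, BF (f x) (f y) = BE x y) ∧
      ∀ s : σ.domain, f s = σ s := by
  refine hσ.exists_linearMap fun τ h1 h2 h3 => ?_
  obtain ⟨v, -, hv⟩ := SetLike.exists_of_lt h3.lt_top
  suffices H : (∀ w, (∀ s, BF (τ s) w = 0) → ∃ s, τ s = w) →
      ¬ ∃ s : τ.domain, ∀ t : τ.domain, BE t (v - s) = 0 by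
    obtain ⟨ρ, h4, h5, h6⟩ := h2.exists_extend_of_orthogonal hE hF hF' hv H
    exact ⟨ρ, h4, fun e => hv (e ▸ h5), h6⟩
  -- Write `D` for the domain of `τ`. As the range contains its orthogonal complement, `dim F - dim
  -- D ≤ dim (D ∩ D^⊥) ≤ dim D^⊥ = dim E - dim D ≤ dim F - dim D`. Hence `D^⊥ ⊆ D`, and `v - s ∈
  -- D^⊥` forces `v ∈ D`.
  rintro h ⟨s, hs⟩
  have d1 := LinearMap.BilinForm.finrank_orthogonal hF' (LinearMap.range τ.toFun)
  have d2 := LinearMap.BilinForm.finrank_orthogonal hE' τ.domain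
  have d3 := LinearMap.finrank_range_of_inj h2.injective
  have d4 : Module.finrank k (BF.orthogonal (LinearMap.range τ.toFun)) ≤
      Module.finrank k ↥((BE.orthogonal τ.domain).comap τ.domain.subtype) := by
    refine le_of_le_of_eq (Submodule.finrank_mono fun w hw => ?_)
      (Submodule.equivMapOfInjective τ.toFun h2.injective _).finrank_eq.symm
    rw [LinearMap.BilinForm.mem_orthogonal_iff] at hw
    obtain ⟨t, rfl⟩ := h w fun s => hw _ ⟨s, rfl⟩
    refine ⟨t, ?_, rfl⟩
    refine LinearMap.BilinForm.mem_orthogonal_iff.2 fun s hs => ?_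
    exact (h2.form_map ⟨s, hs⟩ t).symm.trans (hw _ ⟨_, rfl⟩)
  have d5 : Module.finrank k ↥((BE.orthogonal τ.domain).comap τ.domain.subtype) =
      Module.finrank k ↥(τ.domain ⊓ BE.orthogonal τ.domain) := by
    rw [← Submodule.map_comap_subtype]
    exact (Submodule.equivMapOfInjective _ τ.domain.injective_subtype _).finrank_eq
  have d6 : τ.domain ⊓ BE.orthogonal τ.domain = BE.orthogonal τ.domain := by
    refine Submodule.eq_of_le_of_finrank_le inf_le_right ?_
    omega
  have : v - s ∈ BE.orthogonal τ.domain :=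
    LinearMap.BilinForm.mem_orthogonal_iff.2 fun t ht => hs ⟨t, ht⟩
  rw [← d6] at this
  exact hv (by simpa using add_mem this.1 s.2)

/-- An isometric map from a nondegenerate subspace of a space with an alternating form into a
nondegenerate space of large dimension extends to the whole space. -/
theorem IsIsometric.exists_linearMap_of_lt_finrank [FiniteDimensional k E] [FiniteDimensional k F]
    (hE : BE.IsAlt) (hF : BF.IsAlt) (hF' : BF.Nondegenerate) {σ : E →ₗ.[k] F}
    (hσ : σ.IsIsometric BE BF) (hnd : ∀ s : σ.domain, (∀ t : σ.domain, BE t s = 0) → s = 0)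
    (hlt : 2 * Module.finrank k E < Module.finrank k F + Module.finrank k σ.domain + 2) :
    ∃ f : E →ₗ[k] F, Function.Injective f ∧ (∀ x y, BF (f x) (f y) = BE x y) ∧
      ∀ s : σ.domain, f s = σ s := by
  refine hσ.exists_linearMap fun τ h1 h2 h3 => ?_
  obtain ⟨v, -, hv⟩ := SetLike.exists_of_lt h3.lt_top
  suffices H : (∀ w, (∀ s, BF (τ s) w = 0) → ∃ s, τ s = w) →
      ¬ ∃ s : τ.domain, ∀ t : τ.domain, BE t (v - s) = 0 by
    obtain ⟨ρ, h4, h5, h6⟩ := h2.exists_extend_of_orthogonal hE hF hF' hv H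
    exact ⟨ρ, h4, fun e => hv (e ▸ h5), h6⟩
  -- The range of `τ` contains both its orthogonal complement and the range of `σ`, which meet only
  -- in zero since the domain of `σ` is nondegenerate. So `dim F + dim σ.domain ≤ 2 * dim τ.domain ≤
  -- 2 * dim E - 2`, against `hlt`.
  rintro h ⟨s, hs⟩
  have d0 := Submodule.finrank_lt h3
  have d1 := LinearMap.BilinForm.finrank_orthogonal hF' (LinearMap.range τ.toFun)
  have d2 := LinearMap.finrank_range_of_inj h2.injective
  have d3 := LinearMap.finrank_range_of_inj hσ.injective
  have d4 : Disjoint (LinearMap.range σ.toFun) (BF.orthogonal (LinearMap.range τ.toFun)) := by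
    rw [Submodule.disjoint_def]
    rintro _ ⟨s, rfl⟩ hs
    rw [LinearMap.BilinForm.mem_orthogonal_iff] at hs
    rw [hnd s fun t => ?_, _root_.map_zero]
    rw [← hσ.form_map]
    exact hs _ ⟨⟨t, h1.1 t.2⟩, (h1.2 rfl).symm⟩
  have d5 : LinearMap.range σ.toFun ⊔ BF.orthogonal (LinearMap.range τ.toFun) ≤
      LinearMap.range τ.toFun := by
    refine sup_le ?_ fun w hw => ?_
    · rintro _ ⟨s, rfl⟩
      exact ⟨⟨s, h1.1 s.2⟩, (h1.2 rfl).symm⟩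
    · rw [LinearMap.BilinForm.mem_orthogonal_iff] at hw
      exact h w fun s => hw _ ⟨s, rfl⟩
  have d6 := Submodule.finrank_mono d5
  have d7 := Submodule.finrank_sup_add_finrank_inf_eq (LinearMap.range σ.toFun)
    (BF.orthogonal (LinearMap.range τ.toFun))
  rw [d4.eq_bot, finrank_bot] at d7
  omega

end LinearPMap

/-! ### Witt's theorem in `SI(k)` and stabilisers of embeddings -/

namespace SI

variable {k : Type u} [Field k]

@[simp]
theorem comp_toLinearMap {U V W : SI.{u} k} (f : U ⟶ V) (g : V ⟶ W) :
    Hom.toLinearMap (f ≫ g) = g.toLinearMap ∘ₗ f.toLinearMap := rfl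

theorem hom_ext {V W : SI.{u} k} {f g : V ⟶ W} (h : ∀ x, f.toLinearMap x = g.toLinearMap x) :
    f = g :=
  Hom.ext (LinearMap.ext h)

theorem comp_right_injective {U V W : SI.{u} k} (g : V ⟶ W) :
    Function.Injective fun f : U ⟶ V => f ≫ g := fun _ _ h =>
  hom_ext fun x => g.injective (LinearMap.congr_fun (congrArg Hom.toLinearMap h) x)

theorem isIso_of_dim_le {V W : SI.{u} k} (f : V ⟶ W) (h : W.dim ≤ V.dim) : IsIso f := by
  let e := LinearEquiv.ofInjectiveOfFinrankEq f.toLinearMap f.injective (le_antisymm (dim_le f) h)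
  have he : ∀ x, e x = f.toLinearMap x := fun _ => rfl
  refine ⟨⟨e.symm.toLinearMap, e.symm.injective, fun x y => ?_⟩, hom_ext fun x => ?_,
    hom_ext fun x => ?_⟩
  · rw [← f.form_map]
    change W.form (e (e.symm x)) (e (e.symm y)) = _
    simp
  · exact e.symm_apply_apply x
  · exact e.apply_symm_apply x

/-- The partial isometry `α x ↦ β x` defined by two linear maps that induce the same form and have
the same kernel. -/
theorem exists_isIsometric {E F₁ F₂ : Type*} [AddCommGroup E] [Module k E] [AddCommGroup F₁]
    [Module k F₁] [AddCommGroup F₂] [Module k F₂] {B₁ : LinearMap.BilinForm k F₁}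
    {B₂ : LinearMap.BilinForm k F₂} (α : E →ₗ[k] F₁) (β : E →ₗ[k] F₂)
    (hform : ∀ x y, B₁ (α x) (α y) = B₂ (β x) (β y)) (hker : ∀ x, α x = 0 ↔ β x = 0) :
    ∃ σ : F₁ →ₗ.[k] F₂, σ.IsIsometric B₁ B₂ ∧ σ.domain = LinearMap.range α ∧
      ∀ x (hx : α x ∈ σ.domain), σ ⟨α x, hx⟩ = β x := by
  -- A linear section of `α` over its image; its choice does not affect `β ∘ s`, because `α` and `β`
  -- have the same kernel.
  obtain ⟨s, hs⟩ := α.rangeRestrict.exists_rightInverse_of_surjective α.range_rangeRestrict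
  have hs' : ∀ y : LinearMap.range α, α (s y) = y := fun y =>
    congrArg Subtype.val (LinearMap.congr_fun hs y)
  refine ⟨⟨LinearMap.range α, β ∘ₗ s⟩, ⟨?_, fun x y => ?_⟩, rfl, fun x hx => ?_⟩
  · refine (injective_iff_map_eq_zero (β ∘ₗ s)).2 fun y hy => ?_
    have := (hker _).2 hy
    rw [hs'] at this
    exact Subtype.ext this
  · refine (hform _ _).symm.trans ?_
    rw [hs', hs']
  · change β (s ⟨α x, hx⟩) = β x
    rw [← sub_eq_zero, ← map_sub, ← hker, map_sub, hs', sub_self]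

theorem nonempty_hom_of_dim_le {V W : SI.{u} k} (h : V.dim ≤ W.dim) : Nonempty (V ⟶ W) := by
  have h0 : (⊥ : V.carrier →ₗ.[k] W.carrier).IsIsometric V.form W.form := by
    have : ∀ x : (⊥ : V.carrier →ₗ.[k] W.carrier).domain, x = 0 := fun x =>
      Subtype.ext ((Submodule.mem_bot k).1 x.2)
    refine ⟨fun x y _ => by rw [this x, this y], fun x y => ?_⟩
    rw [this x]
    simp
  obtain ⟨f, h1, h2, -⟩ := h0.exists_linearMap_of_finrank_le V.isAlt V.nondegenerate W.isAlt
    W.nondegenerate h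
  exact ⟨⟨f, h1, h2⟩⟩

/-- **Witt's theorem**: linear maps to a symplectic space that induce the same form and have the
same kernel differ by an automorphism. -/
theorem exists_iso_comp_eq {V : SI.{u} k} {E : Type*} [AddCommGroup E] [Module k E]
    (α β : E →ₗ[k] V.carrier) (hform : ∀ x y, V.form (α x) (α y) = V.form (β x) (β y))
    (hker : ∀ x, α x = 0 ↔ β x = 0) : ∃ g : V ≅ V, ∀ x, g.hom.toLinearMap (α x) = β x := by
  obtain ⟨σ, h1, h2, h3⟩ := exists_isIsometric α β hform hker
  obtain ⟨f, h4, h5, h6⟩ := h1.exists_linearMap_of_finrank_le V.isAlt V.nondegenerate V.isAlt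
    V.nondegenerate le_rfl
  let f' : V ⟶ V := ⟨f, h4, h5⟩
  have := isIso_of_dim_le f' le_rfl
  refine ⟨asIso f', fun x => ?_⟩
  have hx : α x ∈ σ.domain := h2 ▸ ⟨x, rfl⟩
  exact (h6 ⟨α x, hx⟩).trans (h3 x hx)

theorem exists_iso_hom_comp_eq {U V : SI.{u} k} (f g : U ⟶ V) : ∃ e : V ≅ V, f ≫ e.hom = g := by
  obtain ⟨e, he⟩ := exists_iso_comp_eq f.toLinearMap g.toLinearMap
    (fun x y => (f.form_map x y).trans (g.form_map x y).symm)
    (fun x => (map_eq_zero_iff _ f.injective).trans (map_eq_zero_iff _ g.injective).symm)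
  exact ⟨e, hom_ext he⟩

theorem dim_std (n : ℕ) : (std k n).dim = 2 * n := by
  change Module.finrank k (Fin n × Fin 2 → k) = _
  rw [Module.finrank_fintype_fun_eq_card]
  simp [mul_comm]

/-- In dimension `2 * n + 1`, the orthogonal complement of an embedded `std k n` would be a line.
That line would be orthogonal to the embedded space and to itself, hence to everything. -/
theorem even_dim (V : SI.{u} k) : ∃ n, V.dim = 2 * n := by
  by_contra! hodd
  obtain ⟨n, hn⟩ : ∃ n, V.dim = 2 * n + 1 := by
    obtain ⟨n, hn⟩ := Nat.even_or_odd' V.dim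
    exact ⟨n, hn.resolve_left (hodd n)⟩
  obtain ⟨f⟩ := nonempty_hom_of_dim_le (V := std k n) (W := V) (by rw [dim_std]; omega)
  have d1 := LinearMap.BilinForm.finrank_orthogonal V.nondegenerate (LinearMap.range f.toLinearMap)
  rw [LinearMap.finrank_range_of_inj f.injective] at d1
  change _ = V.dim - (std k n).dim at d1
  rw [dim_std, hn, Nat.add_sub_cancel_left] at d1
  obtain ⟨⟨v, hv⟩, hv0, hspan⟩ := finrank_eq_one_iff'.1 d1
  rw [LinearMap.BilinForm.mem_orthogonal_iff] at hv
  have d2 : Disjoint (LinearMap.range f.toLinearMap) (Submodule.span k {v}) := by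
    rw [Submodule.disjoint_def]
    rintro _ ⟨x, rfl⟩ hx
    obtain ⟨c, hc⟩ := Submodule.mem_span_singleton.1 hx
    have : x = 0 := (std k n).nondegenerate.2 x fun y => by
      rw [← f.form_map, ← hc, map_smul, hv _ ⟨y, rfl⟩, smul_zero]
    rw [this, map_zero]
  have hv0' : v ≠ 0 := fun h => hv0 (Subtype.ext h)
  have d3 := Submodule.finrank_sup_add_finrank_inf_eq (LinearMap.range f.toLinearMap)
    (Submodule.span k {v})
  rw [d2.eq_bot, finrank_bot, LinearMap.finrank_range_of_inj f.injective,
    finrank_span_singleton hv0'] at d3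
  change _ = (std k n).dim + 1 at d3
  have d4 := Submodule.eq_top_of_finrank_eq (d3.trans ((congrArg (· + 1) (dim_std n)).trans hn.symm))
  refine hv0' (V.nondegenerate.2 v fun x => ?_)
  obtain ⟨_, ⟨y, rfl⟩, z, hz, rfl⟩ := Submodule.mem_sup.1 (d4 ▸ Submodule.mem_top : x ∈ _)
  obtain ⟨c, rfl⟩ := Submodule.mem_span_singleton.1 hz
  simp [hv _ ⟨y, rfl⟩, V.isAlt v]

theorem nonempty_iso_of_dim_eq {V W : SI.{u} k} (h : V.dim = W.dim) : Nonempty (V ≅ W) := by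
  obtain ⟨f⟩ := nonempty_hom_of_dim_le h.le
  have := isIso_of_dim_le f h.ge
  exact ⟨asIso f⟩

theorem exists_iso_std (V : SI.{u} k) : ∃ n, Nonempty (std k n ≅ V) := by
  obtain ⟨n, hn⟩ := V.even_dim
  exact ⟨n, nonempty_iso_of_dim_eq ((dim_std n).trans hn.symm)⟩

/-- The stabiliser of an embedding in the automorphism group of its target. -/
def fixer {U V : SI.{u} k} (ι : U ⟶ V) : Subgroup (Aut V) where
  carrier := {g | ι ≫ g.hom = ι}
  mul_mem' {a b} ha hb := by
    change ι ≫ b.hom ≫ a.hom = ι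
    exact (Category.assoc _ _ _).symm.trans ((congrArg (· ≫ a.hom) hb).trans ha)
  one_mem' := Category.comp_id ι
  inv_mem' {a} ha := (Iso.comp_inv_eq a).2 (Eq.symm ha)

theorem mem_fixer {U V : SI.{u} k} {ι : U ⟶ V} {g : Aut V} : g ∈ fixer ι ↔ ι ≫ g.hom = ι :=
  Iff.rfl

/-- The maps `(ι', f₁)` and `(ι', f₂)` from `U × X` to `V'` agree after composing the first with `φ
≫ h` and the second with `φ`. They therefore induce the same form and have the same kernel, and
Witt's theorem in `V'` applies. -/
theorem exists_fixer_comp_eq {U V V' X : SI.{u} k} (ι' : U ⟶ V') (φ : V' ⟶ V) (f₁ f₂ : X ⟶ V')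
    (h : Aut V) (hh : h ∈ fixer (ι' ≫ φ)) (hf : f₁ ≫ φ ≫ h.hom = f₂ ≫ φ) :
    ∃ g ∈ fixer ι', f₁ ≫ g.hom = f₂ := by
  have key : ∀ z : U.carrier × X.carrier,
      (φ ≫ h.hom).toLinearMap ((ι'.toLinearMap.coprod f₁.toLinearMap) z) =
        φ.toLinearMap ((ι'.toLinearMap.coprod f₂.toLinearMap) z) := fun z => by
    have e1 := LinearMap.congr_fun (congrArg Hom.toLinearMap (mem_fixer.1 hh)) z.1
    have e2 := LinearMap.congr_fun (congrArg Hom.toLinearMap hf) z.2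
    simp only [comp_toLinearMap, LinearMap.comp_apply] at e1 e2
    simp [e1, e2]
  obtain ⟨g, hg⟩ := exists_iso_comp_eq (ι'.toLinearMap.coprod f₁.toLinearMap)
    (ι'.toLinearMap.coprod f₂.toLinearMap)
    (fun x y => by rw [← (φ ≫ h.hom).form_map, key, key, φ.form_map])
    (fun x => by
      rw [← map_eq_zero_iff _ (φ ≫ h.hom).injective, key, map_eq_zero_iff _ φ.injective])
  refine ⟨g, hom_ext fun x => ?_, hom_ext fun x => ?_⟩
  · simpa using hg (x, 0)
  · simpa using hg (0, x)

/-- The subspace `S = U + f(X)` of `V` has dimension at most `2 * dim U` but may be degenerate.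
Since `U` is nondegenerate and `2 * (2 * dim U) < 3 * dim U + dim U + 2`, the embedding `ι'` of `U`
extends to an isometric embedding of `S` in `V'`. Witt's theorem in `V` then realises it by an
automorphism fixing `U`. This is the source of the factor 3. -/
theorem exists_fixer_comp_eq_comp {U V V' X : SI.{u} k} (ι' : U ⟶ V') (φ : V' ⟶ V) (f : X ⟶ V)
    (hX : X.dim ≤ U.dim) (hV : 3 * U.dim ≤ V'.dim) :
    ∃ g ∈ fixer (ι' ≫ φ), ∃ f' : X ⟶ V', f ≫ g.hom = f' ≫ φ := by
  let ι := ι' ≫ φ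
  let α : U.carrier × X.carrier →ₗ[k] V.carrier := ι.toLinearMap.coprod f.toLinearMap
  let BS : LinearMap.BilinForm k (LinearMap.range α) :=
    V.form.compl₁₂ (LinearMap.range α).subtype (LinearMap.range α).subtype
  have hBS : BS.IsAlt := fun x => V.isAlt x
  have hα : ∀ x, ι.toLinearMap x = α (x, 0) := fun x => by simp [α]
  let ιS : U.carrier →ₗ[k] LinearMap.range α :=
    ι.toLinearMap.codRestrict _ fun x => ⟨(x, 0), (hα x).symm⟩
  obtain ⟨σ, h1, h2, h3⟩ := exists_isIsometric (B₁ := BS) (B₂ := V'.form) ιS ι'.toLinearMap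
    (fun x y => (ι.form_map x y).trans (ι'.form_map x y).symm)
    (fun x => by
      rw [map_eq_zero_iff _ ι'.injective, ← map_eq_zero_iff _ ι.injective]
      exact Subtype.ext_iff)
  have hιS : Function.Injective ιS := fun x y h => ι.injective (congrArg Subtype.val h)
  obtain ⟨β, h4, h5, h6⟩ := h1.exists_linearMap_of_lt_finrank hBS V'.isAlt V'.nondegenerate
    (fun s hs => by
      obtain ⟨s, hs'⟩ := s
      obtain ⟨x, rfl⟩ : s ∈ LinearMap.range ιS := h2 ▸ hs'
      have : x = 0 := U.nondegenerate.2 x fun y => by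
        rw [← ι.form_map]
        exact hs ⟨ιS y, h2 ▸ ⟨y, rfl⟩⟩
      subst this
      simp)
    (by
      rw [h2, LinearMap.finrank_range_of_inj hιS]
      have d1 := LinearMap.finrank_range_le α
      rw [Module.finrank_prod] at d1
      unfold dim at hX hV
      omega)
  obtain ⟨g, hg⟩ := exists_iso_comp_eq (LinearMap.range α).subtype (φ.toLinearMap ∘ₗ β)
    (fun x y => by simp [φ.form_map, h5]; rfl)
    (fun x => by
      rw [LinearMap.comp_apply, map_eq_zero_iff _ φ.injective, map_eq_zero_iff _ h4]
      simp)
  have hfα : ∀ x, f.toLinearMap x = α (0, x) := fun x => by simp [α]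
  let fS : X.carrier →ₗ[k] LinearMap.range α :=
    f.toLinearMap.codRestrict _ fun x => ⟨(0, x), (hfα x).symm⟩
  refine ⟨g, hom_ext fun x => ?_, ⟨β ∘ₗ fS, h4.comp fun x y h => f.injective (congrArg Subtype.val h),
    fun x y => ?_⟩, hom_ext fun x => hg (fS x)⟩
  · have hx : ιS x ∈ σ.domain := h2 ▸ ⟨x, rfl⟩
    have e1 := hg (ιS x)
    have e2 := (h6 ⟨ιS x, hx⟩).trans (h3 x hx)
    exact e1.trans (congrArg φ.toLinearMap e2)
  · exact (h5 _ _).trans (f.form_map x y)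

theorem exists_fixer_comp_comp_eq {U V V' : SI.{u} k} (ι' : U ⟶ V') (φ : V' ⟶ V) (h' : Aut V')
    (hh : h' ∈ fixer ι') : ∃ h ∈ fixer (ι' ≫ φ), φ ≫ h.hom = h'.hom ≫ φ := by
  obtain ⟨h, e⟩ := exists_iso_hom_comp_eq φ (h'.hom ≫ φ)
  refine ⟨h, mem_fixer.2 ?_, e⟩
  rw [Category.assoc, e, ← Category.assoc, mem_fixer.1 hh]

instance [Finite k] (V W : SI.{u} k) : Finite (V ⟶ W) := by
  have : Finite V.carrier := Module.finite_of_finite k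
  have : Finite W.carrier := Module.finite_of_finite k
  exact Finite.of_injective (fun f : V ⟶ W => (fun x => f.toLinearMap x)) fun f g h =>
    hom_ext fun x => congrFun h x

instance [Finite k] (V : SI.{u} k) : Finite (Aut V) :=
  Finite.of_injective (fun g : Aut V => g.hom) fun _ _ h => Iso.ext h

end SI

/-! ### Generation degrees, sums over stabilisers, free modules -/

namespace SIMod

variable {k : Type u} [Field k] {R : Type v}

section CommRing

variable [CommRing R]

/-- The map `f_* : A_V → A_W` as a linear map. -/
noncomputable def push (A : SIMod.{u, v} k R) {V W : SI.{u} k} (f : V ⟶ W) :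
    A.obj V →ₗ[R] A.obj W := (A.map f).hom

/-- The component of a morphism of `SI(k)`-modules as a linear map. -/
noncomputable def component {A B : SIMod.{u, v} k R} (φ : A ⟶ B) (V : SI.{u} k) :
    A.obj V →ₗ[R] B.obj V := (φ.app V).hom

theorem push_comp (A : SIMod.{u, v} k R) {U V W : SI.{u} k} (f : U ⟶ V) (g : V ⟶ W)
    (x : A.obj U) : push A (f ≫ g) x = push A g (push A f x) := by
  simp [push]

theorem push_id (A : SIMod.{u, v} k R) {V : SI.{u} k} (x : A.obj V) : push A (𝟙 V) x = x := by
  simp [push]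

theorem component_push {A B : SIMod.{u, v} k R} (φ : A ⟶ B) {V W : SI.{u} k} (f : V ⟶ W)
    (x : A.obj V) : component φ W (push A f x) = push B f (component φ V x) :=
  NatTrans.naturality_apply φ f x

theorem push_mul (A : SIMod.{u, v} k R) {V : SI.{u} k} (g h : Aut V) (x : A.obj V) :
    push A (g * h).hom x = push A g.hom (push A h.hom x) :=
  push_comp A h.hom g.hom x

theorem push_inv_push (A : SIMod.{u, v} k R) {V : SI.{u} k} (g : Aut V) (x : A.obj V) :
    push A (g⁻¹).hom (push A g.hom x) = x := by
  rw [← push_mul, inv_mul_cancel]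
  exact push_id A x

theorem push_push_inv (A : SIMod.{u, v} k R) {V : SI.{u} k} (g : Aut V) (x : A.obj V) :
    push A g.hom (push A (g⁻¹).hom x) = x := by
  rw [← push_mul, mul_inv_cancel]
  exact push_id A x

theorem push_mem_lower (A : SIMod.{u, v} k R) {W V : SI.{u} k} (f : W ⟶ V) (h : W.dim < V.dim)
    (a : A.obj W) : push A f a ∈ lower A V :=
  Submodule.subset_span ⟨W, f, a, h, rfl⟩

theorem push_mem_lower_of_mem (A : SIMod.{u, v} k R) {W V : SI.{u} k} (f : W ⟶ V) {a : A.obj W}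
    (ha : a ∈ lower A W) : push A f a ∈ lower A V :=
  lower_le_comap A f ha

theorem component_mem_lower {A B : SIMod.{u, v} k R} (φ : A ⟶ B) {V : SI.{u} k} {a : A.obj V}
    (ha : a ∈ lower A V) : component φ V a ∈ lower B V :=
  lower_le_comap_app φ V ha

variable (A : SIMod.{u, v} k R)

theorem isZero_H0_obj_iff (V : SI.{u} k) : IsZero (((H0 k R).obj A).obj V) ↔ lower A V = ⊤ := by
  rw [ModuleCat.isZero_iff_subsingleton]
  exact Submodule.Quotient.subsingleton_iff

theorem lower_eq_top_of_iso {V W : SI.{u} k} (e : V ≅ W) (h : lower A V = ⊤) : lower A W = ⊤ := by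
  refine eq_top_iff.2 fun x _ => ?_
  have := push_mem_lower_of_mem A e.hom (a := push A e.inv x) (h ▸ Submodule.mem_top)
  rwa [← push_comp, e.inv_hom_id, push_id] at this

/-- An `SI(k)`-module is generated in degrees `≤ N` if it is spanned by the images of its values at
`k ^ (2 * m)` with `m ≤ N`. -/
def GeneratedInDegree (N : ℕ) : Prop :=
  ∀ (V : SI.{u} k) (x : A.obj V), x ∈ Submodule.span R
    {y | ∃ m ≤ N, ∃ (f : SI.std k m ⟶ V) (a : A.obj (SI.std k m)), push A f a = y}

variable {A}

theorem GeneratedInDegree.lower_eq_top {N : ℕ} (h : GeneratedInDegree A N) {V : SI.{u} k}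
    (hV : 2 * N < V.dim) : lower A V = ⊤ := by
  refine eq_top_iff.2 fun x _ => Submodule.span_le.2 ?_ (h V x)
  rintro _ ⟨m, hm, f, a, rfl⟩
  exact push_mem_lower A f (by rw [SI.dim_std]; omega) a

/-- Strong induction on the dimension. The general predicate `p` also covers the case without any
generating degree, where the module is zero. -/
theorem span_eq_top_of_lower_eq_top {p : ℕ → Prop} (h : ∀ n, ¬ p n → lower A (SI.std k n) = ⊤)
    (V : SI.{u} k) (x : A.obj V) : x ∈ Submodule.span R
      {y | ∃ m, p m ∧ ∃ (f : SI.std k m ⟶ V) (a : A.obj (SI.std k m)), push A f a = y} := by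
  induction hd : V.dim using Nat.strong_induction_on generalizing V with
  | _ d ih =>
    subst hd
    obtain ⟨n, ⟨e⟩⟩ := V.exists_iso_std
    by_cases hn : p n
    · refine Submodule.subset_span ⟨n, hn, e.hom, push A e.inv x, ?_⟩
      rw [← push_comp, e.inv_hom_id, push_id]
    · have hx : x ∈ lower A V := lower_eq_top_of_iso A e (h n hn) ▸ Submodule.mem_top
      refine Submodule.span_le.2 ?_ hx
      rintro _ ⟨W, f, a, hW, rfl⟩
      have := Submodule.mem_map_of_mem (f := push A f) (ih _ hW W a rfl)
      rw [Submodule.map_span] at this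
      refine Submodule.span_mono ?_ this
      rintro _ ⟨_, ⟨m, hm, g, b, rfl⟩, rfl⟩
      exact ⟨m, hm, g ≫ f, b, push_comp A g f b⟩

theorem generatedInDegree_iff {N : ℕ} :
    GeneratedInDegree A N ↔ ∀ n, N < n → lower A (SI.std k n) = ⊤ :=
  ⟨fun h n hn => h.lower_eq_top (by rw [SI.dim_std]; omega), fun h =>
    span_eq_top_of_lower_eq_top (p := (· ≤ N)) fun n hn => h n (not_le.1 hn)⟩

section Finite

variable [Finite k]

noncomputable instance (V : SI.{u} k) : Fintype (Aut V) := Fintype.ofFinite _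

noncomputable instance {U V : SI.{u} k} (ι : U ⟶ V) : Fintype (SI.fixer ι) := Fintype.ofFinite _

variable (A) in
/-- The sum of the translates of an element under the stabiliser of an embedding. -/
noncomputable def fixerSum {U V : SI.{u} k} (ι : U ⟶ V) : A.obj V →ₗ[R] A.obj V :=
  ∑ g : SI.fixer ι, push A g.1.hom

variable (A) in
theorem fixerSum_apply {U V : SI.{u} k} (ι : U ⟶ V) (x : A.obj V) :
    fixerSum A ι x = ∑ g : SI.fixer ι, push A g.1.hom x := by
  simp [fixerSum]

variable (A) in
theorem fixerSum_push {U V : SI.{u} k} (ι : U ⟶ V) {g : Aut V} (hg : g ∈ SI.fixer ι)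
    (x : A.obj V) : fixerSum A ι (push A g.hom x) = fixerSum A ι x := by
  rw [fixerSum_apply, fixerSum_apply]
  refine Fintype.sum_equiv (Equiv.mulRight ⟨g, hg⟩) _ _ fun h => ?_
  exact (push_mul A h.1 g x).symm

variable (A) in
theorem push_fixerSum {U V : SI.{u} k} (ι : U ⟶ V) {g : Aut V} (hg : g ∈ SI.fixer ι)
    (x : A.obj V) : push A g.hom (fixerSum A ι x) = fixerSum A ι x := by
  rw [fixerSum_apply, map_sum]
  refine Fintype.sum_equiv (Equiv.mulLeft ⟨g, hg⟩) _ _ fun h => ?_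
  exact (push_mul A g h.1 x).symm

theorem fixerSum_of_fixed {U V : SI.{u} k} (ι : U ⟶ V) {x : A.obj V}
    (hx : ∀ g ∈ SI.fixer ι, push A g.hom x = x) :
    fixerSum A ι x = Fintype.card (SI.fixer ι) • x := by
  rw [fixerSum_apply, Finset.sum_congr rfl fun g _ => hx g.1 g.2]
  simp

theorem component_fixerSum {B : SIMod.{u, v} k R} (φ : A ⟶ B) {U V : SI.{u} k} (ι : U ⟶ V)
    (x : A.obj V) : component φ V (fixerSum A ι x) = fixerSum B ι (component φ V x) := by
  simp [fixerSum_apply, component_push]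

variable (A) in
-- Each element of the stabiliser in `V'` is induced by one in `V`, and the outer sum absorbs it.
theorem fixerSum_push_fixerSum {U V' V : SI.{u} k} (ι : U ⟶ V') (φ : V' ⟶ V) (x : A.obj V') :
    fixerSum A (ι ≫ φ) (push A φ (fixerSum A ι x)) =
      Fintype.card (SI.fixer ι) • fixerSum A (ι ≫ φ) (push A φ x) := by
  rw [fixerSum_apply A ι, map_sum, map_sum]
  rw [Finset.sum_congr rfl (g := fun _ => fixerSum A (ι ≫ φ) (push A φ x)) fun g _ => ?_]
  · simp
  · obtain ⟨h, hh, e⟩ := SI.exists_fixer_comp_comp_eq ι φ g.1 g.2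
    rw [← push_comp, ← e, push_comp, fixerSum_push A _ hh]

/-- A generator `f` can be moved into `V'` by an automorphism fixing `U`, which the sum over the
stabiliser does not detect. -/
theorem GeneratedInDegree.exists_fixerSum_push_eq {N : ℕ} (hA : GeneratedInDegree A N)
    {U V' V : SI.{u} k} (ι : U ⟶ V') (φ : V' ⟶ V) (hU : U.dim = 2 * N) (hV' : 6 * N ≤ V'.dim)
    (x : A.obj V) : ∃ z, fixerSum A (ι ≫ φ) (push A φ z) = fixerSum A (ι ≫ φ) x := by
  refine Submodule.span_induction ?_ ⟨0, by simp⟩ ?_ ?_ (hA V x)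
  · rintro _ ⟨m, hm, f, a, rfl⟩
    obtain ⟨g, hg, f', e⟩ := SI.exists_fixer_comp_eq_comp ι φ f (by rw [SI.dim_std]; omega)
      (by omega)
    exact ⟨push A f' a, by rw [← push_comp, ← e, push_comp, fixerSum_push A _ hg]⟩
  · rintro x y - - ⟨z, hz⟩ ⟨w, hw⟩
    exact ⟨z + w, by simp only [map_add, hz, hw]⟩
  · rintro c x - ⟨z, hz⟩
    exact ⟨c • z, by simp only [map_smul, hz]⟩

end Finite

/-- A generator comes from a space of dimension at most `dim U`, so a translate of it factors
through `ι`, and whatever comes from `U` is fixed by the stabiliser. Unlike generation in degrees `≤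
N`, this property passes to submodules in characteristic zero. -/
theorem GeneratedInDegree.mem_span_fixed {N : ℕ} (hA : GeneratedInDegree A N)
    {U V : SI.{u} k} (ι : U ⟶ V) (hU : U.dim = 2 * N) (x : A.obj V) :
    x ∈ Submodule.span R {y | ∃ (g : Aut V) (t : A.obj V),
      (∀ h ∈ SI.fixer ι, push A h.hom t = t) ∧ push A g.hom t = y} := by
  refine Submodule.span_mono ?_ (hA V x)
  rintro _ ⟨m, hm, f, a, rfl⟩
  obtain ⟨j⟩ := SI.nonempty_hom_of_dim_le (V := SI.std k m) (W := U) (by rw [SI.dim_std]; omega)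
  obtain ⟨g, hg⟩ := SI.exists_iso_hom_comp_eq (j ≫ ι) f
  refine ⟨g, push A (j ≫ ι) a, fun h hh => ?_, by rw [← push_comp, hg]⟩
  rw [← push_comp, Category.assoc, SI.mem_fixer.1 hh]

/-- The `SI(k)`-module `V ↦ ⨁ j, E ⊗ R[Hom(X j, V)]`. -/
noncomputable def free {J : Type} (X : J → SI.{u} k) (E : Type (max u v)) [AddCommGroup E]
    [Module R E] : SIMod.{u, v} k R where
  obj V := ModuleCat.of R ((Σ j, X j ⟶ V) →₀ E)
  map g := ModuleCat.ofHom (Finsupp.lmapDomain E R fun p => ⟨p.1, p.2 ≫ g⟩)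
  map_id V := by
    ext x
    simp
  map_comp f g := by
    ext x
    simp

section Free

variable {J : Type} {X : J → SI.{u} k} {E : Type (max u v)} [AddCommGroup E] [Module R E]


/-- The coefficient of an element of a free module at an embedding. -/
noncomputable def freeCoeff {V : SI.{u} k} (j : J) (f : X j ⟶ V) :
    (free (R := R) X E).obj V →ₗ[R] E := Finsupp.lapply ⟨j, f⟩

theorem free_ext {V : SI.{u} k} {x y : (free (R := R) X E).obj V}
    (h : ∀ (j : J) (f : X j ⟶ V), freeCoeff j f x = freeCoeff j f y) : x = y :=
  Finsupp.ext fun p => h p.1 p.2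

theorem free_map_injective {V W : SI.{u} k} (g : V ⟶ W) :
    Function.Injective fun p : Σ j, X j ⟶ V => (⟨p.1, p.2 ≫ g⟩ : Σ j, X j ⟶ W) := by
  rintro ⟨j, f⟩ ⟨j', f'⟩ h
  obtain ⟨h1, h2⟩ := Sigma.mk.inj h
  dsimp only at h1
  subst h1
  exact congrArg (Sigma.mk j) (SI.comp_right_injective g (eq_of_heq h2))

theorem freeCoeff_push {V W : SI.{u} k} (g : V ⟶ W) (x : (free (R := R) X E).obj V) (j : J)
    (f : X j ⟶ V) : freeCoeff j (f ≫ g) (push (free X E) g x) = freeCoeff j f x :=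
  Finsupp.mapDomain_apply (free_map_injective g) x ⟨j, f⟩

theorem freeCoeff_push_of_forall_ne {V W : SI.{u} k} (g : V ⟶ W) (x : (free (R := R) X E).obj V)
    (j : J) (f : X j ⟶ W) (hf : ∀ f', f' ≫ g ≠ f) : freeCoeff j f (push (free X E) g x) = 0 := by
  refine Finsupp.mapDomain_of_notMem_range _ _ ?_
  rintro ⟨⟨j', f'⟩, h⟩
  obtain ⟨h1, h2⟩ := Sigma.mk.inj h
  dsimp only at h1
  subst h1
  exact hf f' (eq_of_heq h2)

/-- Compare coefficients at `f ≫ φ`. A translate of `x` contributes either zero or the coefficient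
of `x` at some `f'` that differs from `f` by an automorphism fixing `U`, which is the coefficient at
`f` by invariance. The identity contributes, so the total is a positive multiple of that
coefficient. -/
theorem free_eq_zero_of_fixerSum_eq_zero [Finite k] [IsAddTorsionFree E] {U V' V : SI.{u} k}
    (ι : U ⟶ V') (φ : V' ⟶ V) (x : (free (R := R) X E).obj V')
    (hx : ∀ g ∈ SI.fixer ι, push (free X E) g.hom x = x)
    (h : fixerSum (free X E) (ι ≫ φ) (push (free X E) φ x) = 0) : x = 0 := by
  classical
  refine free_ext fun j f => ?_
  have key : ∀ g : SI.fixer (ι ≫ φ),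
      freeCoeff j (f ≫ φ) (push (free (R := R) X E) g.1.hom (push (free X E) φ x)) =
        if ∃ f' : X j ⟶ V', f' ≫ φ ≫ g.1.hom = f ≫ φ then freeCoeff j f x else 0 := by
    intro g
    rw [← push_comp]
    split_ifs with hf
    · obtain ⟨f', hf'⟩ := hf
      obtain ⟨h, hh, e⟩ := SI.exists_fixer_comp_eq ι φ f' f g.1 g.2 hf'
      rw [← hf', freeCoeff_push, ← e]
      conv_rhs => rw [← hx h hh]
      exact (freeCoeff_push h.hom x j f').symm
    · exact freeCoeff_push_of_forall_ne _ _ _ _ fun f' h => hf ⟨f', h⟩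
  have h1 := congrArg (freeCoeff j (f ≫ φ)) h
  rw [fixerSum_apply, map_sum, Finset.sum_congr rfl fun g _ => key g, map_zero,
    ← Finset.sum_filter, Finset.sum_const] at h1
  rw [map_zero]
  refine (smul_eq_zero.1 h1).resolve_left fun h2 => ?_
  rw [Finset.card_eq_zero] at h2
  refine Finset.notMem_empty (1 : SI.fixer (ι ≫ φ)) (h2 ▸ ?_)
  exact Finset.mem_filter.2 ⟨Finset.mem_univ _, f, congrArg (f ≫ ·) (Category.comp_id φ)⟩

end Free

end CommRing

end SIMod

/-! ### Kernels of maps to free modules in characteristic zero -/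

namespace SIMod

variable {k : Type u} [Field k] [Finite k] {R : Type v} [Field R] [CharZero R]

/-- **Maschke's theorem**: an injective morphism of `SI(k)`-modules has at each object a left inverse
that commutes with the automorphisms of that object. -/
theorem exists_equivariant_leftInverse {K P : SIMod.{u, v} k R} (i : K ⟶ P) (V : SI.{u} k)
    (hi : Function.Injective (component i V)) :
    ∃ r : P.obj V →ₗ[R] K.obj V, (∀ x, r (component i V x) = x) ∧
      ∀ (g : Aut V) (y : P.obj V), r (push P g.hom y) = push K g.hom (r y) := by
  obtain ⟨π, hπ⟩ := LinearMap.exists_leftInverse_of_injective _ (LinearMap.ker_eq_bot.2 hi)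
  have hπ' : ∀ x, π (component i V x) = x := fun x => LinearMap.congr_fun hπ x
  have hcard : (Fintype.card (Aut V) : R) ≠ 0 := Nat.cast_ne_zero.2 Fintype.card_ne_zero
  refine ⟨(Fintype.card (Aut V) : R)⁻¹ •
    ∑ g : Aut V, push K g.hom ∘ₗ π ∘ₗ push P (g⁻¹).hom, fun x => ?_, fun g y => ?_⟩
  · simp only [LinearMap.smul_apply, LinearMap.sum_apply, LinearMap.comp_apply, ← component_push,
      hπ', push_push_inv]
    rw [Finset.sum_const, Finset.card_univ, ← Nat.cast_smul_eq_nsmul R, smul_smul,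
      inv_mul_cancel₀ hcard, one_smul]
  · simp only [LinearMap.smul_apply, LinearMap.sum_apply, LinearMap.comp_apply, map_smul, map_sum]
    congr 1
    refine (Fintype.sum_equiv (Equiv.mulLeft g) _ _ fun h => ?_).symm
    rw [Equiv.coe_mulLeft, push_mul, mul_inv_rev, push_mul, push_inv_push]

/-- An equivariant retraction carries fixed vectors of `P` to fixed vectors of `K`. -/
theorem mem_span_fixed_of_injective {K P : SIMod.{u, v} k R} (i : K ⟶ P) {N : ℕ}
    (hP : GeneratedInDegree P N) {U V : SI.{u} k} (hi : Function.Injective (component i V))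
    (ι : U ⟶ V) (hU : U.dim = 2 * N) (x : K.obj V) :
    x ∈ Submodule.span R {y | ∃ (g : Aut V) (t : K.obj V),
      (∀ h ∈ SI.fixer ι, push K h.hom t = t) ∧ push K g.hom t = y} := by
  obtain ⟨r, hr, hg⟩ := exists_equivariant_leftInverse i V hi
  have := Submodule.mem_map_of_mem (f := r) (hP.mem_span_fixed ι hU (component i V x))
  rw [hr, Submodule.map_span] at this
  refine Submodule.span_mono ?_ this
  rintro _ ⟨_, ⟨g, t, ht, rfl⟩, rfl⟩
  exact ⟨g, r t, fun h hh => by rw [← hg, ht h hh], (hg g t).symm⟩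

/-- The kernel of a morphism from a module generated in degrees `≤ N` to a free module is generated
in degrees `≤ 3 * N`. -/
theorem GeneratedInDegree.kernel {K P : SIMod.{u, v} k R} {N : ℕ} (hP : GeneratedInDegree P N)
    {J : Type} {X : J → SI.{u} k} {E : Type (max u v)} [AddCommGroup E] [Module R E]
    (i : K ⟶ P) (p : P ⟶ free (R := R) X E)
    (hi : ∀ V, Function.Injective (component i V))
    (hip : ∀ V (x : K.obj V), component p V (component i V x) = 0)
    (hex : ∀ V (y : P.obj V), component p V y = 0 → ∃ x, component i V x = y) :
    GeneratedInDegree K (3 * N) := by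
  refine generatedInDegree_iff.2 fun n hn => ?_
  -- The degree becomes `n + 1` with `n ≥ 3 * N`, so the smaller space `std k n` still has dimension
  -- at least `6 * N`.
  obtain ⟨n, rfl⟩ : ∃ n', n = n' + 1 := ⟨n - 1, by omega⟩
  obtain ⟨ι⟩ := SI.nonempty_hom_of_dim_le (V := SI.std k N) (W := SI.std k n)
    (by rw [SI.dim_std, SI.dim_std]; omega)
  obtain ⟨φ⟩ := SI.nonempty_hom_of_dim_le (V := SI.std k n) (W := SI.std k (n + 1))
    (by rw [SI.dim_std, SI.dim_std]; omega)
  have hφ : (SI.std k n).dim < (SI.std k (n + 1)).dim := by rw [SI.dim_std, SI.dim_std]; omega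
  refine eq_top_iff.2 fun x _ => Submodule.span_le.2 ?_
    (mem_span_fixed_of_injective i hP (hi _) (ι ≫ φ) (SI.dim_std N) x)
  rintro _ ⟨g, t, ht, rfl⟩
  refine push_mem_lower_of_mem K g.hom ?_
  obtain ⟨z, hz⟩ := hP.exists_fixerSum_push_eq ι φ (SI.dim_std N) (by rw [SI.dim_std]; omega)
    (component i _ t)
  have hz' : fixerSum P (ι ≫ φ) (push P φ (fixerSum P ι z)) =
      component i _ ((Fintype.card (SI.fixer ι) * Fintype.card (SI.fixer (ι ≫ φ))) • t) := by
    rw [fixerSum_push_fixerSum, hz, ← component_fixerSum, fixerSum_of_fixed _ ht,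
      ← map_nsmul, smul_smul]
  have : IsAddTorsionFree E := .of_isTorsionFree R E
  -- The image of this vector in the free module is fixed by the stabiliser in `V'`, and its sum
  -- over the stabiliser in `V` is a multiple of the image of `t`, which is zero.
  have h0 : component p _ (fixerSum P ι z) = 0 := by
    refine free_eq_zero_of_fixerSum_eq_zero ι φ _ (fun g hg => ?_) ?_
    · rw [← component_push, push_fixerSum P ι hg]
    · rw [← component_push, ← component_fixerSum, hz', hip]
  obtain ⟨w, hw⟩ := hex _ _ h0
  rw [← hw, ← component_push, ← component_fixerSum] at hz'
  have h1 := hi _ hz'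
  have h2 : (Fintype.card (SI.fixer ι) * Fintype.card (SI.fixer (ι ≫ φ))) • t ∈
      lower K (SI.std k (n + 1)) := by
    rw [← h1, fixerSum_apply]
    exact Submodule.sum_mem _ fun g _ => push_mem_lower_of_mem K _ (push_mem_lower K φ hφ w)
  have hcard : ((Fintype.card (SI.fixer ι) * Fintype.card (SI.fixer (ι ≫ φ)) : ℕ) : R) ≠ 0 :=
    Nat.cast_ne_zero.2 (mul_ne_zero Fintype.card_ne_zero Fintype.card_ne_zero)
  rw [← Nat.cast_smul_eq_nsmul R] at h2
  exact (Submodule.smul_mem_iff _ hcard).1 h2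

end SIMod

/-! ### Splicing a projective resolution with a short exact sequence -/

namespace CategoryTheory.ProjectiveResolution

variable {C : Type*} [Category* C] [Abelian C]

section Splice

variable {S : ShortComplex C} (Q : ProjectiveResolution S.X₁)

/-- The composition of the augmentation of a resolution of `S.X₁` with `S.X₁ ⟶ S.X₂`. -/
noncomputable def spliceMap : Q.complex.X 0 ⟶ S.X₂ := Q.π.f 0 ≫ S.f

theorem d_comp_spliceMap : Q.complex.d 1 0 ≫ spliceMap Q = 0 := by
  rw [spliceMap]
  exact Q.complex_d_comp_π_f_zero_assoc S.f |>.trans zero_comp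

theorem spliceMap_comp : spliceMap Q ≫ S.g = 0 := by
  rw [spliceMap]
  exact (Category.assoc _ _ _).trans ((congrArg _ S.zero).trans comp_zero)

/-- The complex obtained from a resolution of `S.X₁` by inserting `S.X₂` in degree zero. -/
noncomputable def spliceComplex : ChainComplex C ℕ :=
  Q.complex.augment (spliceMap Q) (d_comp_spliceMap Q)

/-- The augmentation of the spliced complex. -/
noncomputable def spliceπ : spliceComplex Q ⟶ (ChainComplex.single₀ C).obj S.X₃ :=
  (ChainComplex.toSingle₀Equiv _ _).symm ⟨S.g, spliceMap_comp Q⟩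

theorem spliceπ_f_zero : (spliceπ Q).f 0 = S.g :=
  ChainComplex.toSingle₀Equiv_symm_apply_f_zero (C := spliceComplex Q) S.g (spliceMap_comp Q)

theorem spliceComplex_exact_zero (hS : S.ShortExact) :
    (ShortComplex.mk (spliceMap Q) S.g (spliceMap_comp Q)).Exact := by
  let α : ShortComplex.mk (spliceMap Q) S.g (spliceMap_comp Q) ⟶ S :=
    { τ₁ := Q.π.f 0
      τ₂ := 𝟙 _
      τ₃ := 𝟙 _
      comm₁₂ := (Category.comp_id _).symm }
  have : Epi α.τ₁ := inferInstanceAs (Epi (Q.π.f 0))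
  have : IsIso α.τ₂ := inferInstanceAs (IsIso (𝟙 _))
  have : Mono α.τ₃ := inferInstanceAs (Mono (𝟙 _))
  exact (ShortComplex.exact_iff_of_epi_of_isIso_of_mono α).2 hS.exact

theorem spliceComplex_exactAt_one (hS : S.ShortExact) : (spliceComplex Q).ExactAt 1 := by
  rw [HomologicalComplex.exactAt_iff' _ 2 1 0 (by simp) (by simp)]
  let α : ShortComplex.mk _ _ Q.complex_d_comp_π_f_zero ⟶ (spliceComplex Q).sc' 2 1 0 :=
    { τ₁ := 𝟙 _
      τ₂ := 𝟙 _
      τ₃ := S.f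
      comm₁₂ := (Category.id_comp _).trans (Category.comp_id _).symm
      comm₂₃ := Category.id_comp _ }
  have : Epi α.τ₁ := inferInstanceAs (Epi (𝟙 _))
  have : IsIso α.τ₂ := inferInstanceAs (IsIso (𝟙 _))
  have : Mono α.τ₃ := hS.mono_f
  exact (ShortComplex.exact_iff_of_epi_of_isIso_of_mono α).1 Q.exact₀

theorem spliceComplex_exactAt_add_two (n : ℕ) : (spliceComplex Q).ExactAt (n + 2) := by
  rw [HomologicalComplex.exactAt_iff' _ (n + 3) (n + 2) (n + 1) (by simp) (by simp)]
  exact Q.exact_succ n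

/-- The projective resolution of `S.X₃` obtained by splicing a short exact sequence `S` with
projective middle term and a projective resolution of `S.X₁`. -/
noncomputable def splice [Projective S.X₂] (hS : S.ShortExact) : ProjectiveResolution S.X₃ where
  complex := spliceComplex Q
  projective
    | 0 => inferInstanceAs (Projective S.X₂)
    | n + 1 => Q.projective n
  π := spliceπ Q
  quasiIso := ⟨fun n => by
    match n with
    | 0 =>
      rw [ChainComplex.quasiIsoAt₀_iff, ShortComplex.quasiIso_iff_of_zeros']
      · have : Epi S.g := hS.epi_g
        refine (ShortComplex.exact_and_epi_g_iff_of_iso ?_).2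
          ⟨spliceComplex_exact_zero Q hS, this⟩
        exact ShortComplex.isoMk (Iso.refl _) (Iso.refl _) (Iso.refl _)
          ((Category.id_comp _).trans (Category.comp_id _).symm)
          (by
            refine (Category.id_comp _).trans (Eq.trans ?_ (Category.comp_id _).symm)
            exact (spliceπ_f_zero Q).symm)
      all_goals rfl
    | 1 =>
      rw [quasiIsoAt_iff_exactAt']
      · exact spliceComplex_exactAt_one Q hS
      · apply ChainComplex.exactAt_succ_single_obj
    | n + 2 =>
      rw [quasiIsoAt_iff_exactAt']
      · exact spliceComplex_exactAt_add_two Q n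
      · apply ChainComplex.exactAt_succ_single_obj⟩

end Splice

end CategoryTheory.ProjectiveResolution

/-! ### Dimension shifting for `SI`-homology -/

namespace SIMod

variable {k : Type u} [Field k] {R : Type v}

section CommRing

variable [CommRing R]

/-- `H_(n + 1)` vanishes at `V` if and only if `H_0` of a projective resolution is exact there. -/
theorem isZero_H_succ_obj_iff {A : SIMod.{u, v} k R} (P : ProjectiveResolution A) (n : ℕ)
    (V : SI.{u} k) : IsZero (((H k R (n + 1)).obj A).obj V) ↔
      ∀ x : (P.complex.X (n + 1)).obj V,
        component (P.complex.d (n + 1) n) V x ∈ lower (P.complex.X n) V →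
          ∃ y, x - component (P.complex.d (n + 2) (n + 1)) V y ∈ lower (P.complex.X (n + 1)) V := by
  let C := ((H0 k R).mapHomologicalComplex (ComplexShape.down ℕ)).obj P.complex
  let S := C.sc' (n + 2) (n + 1) n
  let ev := (evaluation (SI.{u} k) (ModuleCat.{max u v} R)).obj V
  let e : ((H k R (n + 1)).obj A).obj V ≅ (S.map ev).homology :=
    ev.mapIso (P.isoLeftDerivedObj (H0 k R) (n + 1) ≪≫
      C.homologyIsoSc' (n + 2) (n + 1) n (by simp) (by simp)) ≪≫ (S.mapHomologyIso ev).symm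
  rw [e.isZero_iff, ← ShortComplex.exact_iff_isZero_homology, ShortComplex.moduleCat_exact_iff]
  constructor
  · intro h x hx
    obtain ⟨y, hy⟩ := h (Submodule.Quotient.mk x) ((Submodule.Quotient.mk_eq_zero _).2 hx)
    obtain ⟨y, rfl⟩ := Submodule.Quotient.mk_surjective _ y
    exact ⟨y, (Submodule.Quotient.eq _).1 hy.symm⟩
  · intro h x hx
    obtain ⟨x, rfl⟩ := Submodule.Quotient.mk_surjective _ x
    obtain ⟨y, hy⟩ := h x ((Submodule.Quotient.mk_eq_zero _).1 hx)
    exact ⟨Submodule.Quotient.mk y, ((Submodule.Quotient.eq _).2 hy).symm⟩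

end CommRing

end SIMod

namespace SIMod

variable {k : Type u} [Field k] {R : Type v}

section CommRing

variable [CommRing R]

theorem component_comp {A B C : SIMod.{u, v} k R} (φ : A ⟶ B) (ψ : B ⟶ C) (V : SI.{u} k)
    (x : A.obj V) : component (φ ≫ ψ) V x = component ψ V (component φ V x) := rfl

theorem component_surjective {A B : SIMod.{u, v} k R} (φ : A ⟶ B) [Epi φ] (V : SI.{u} k) :
    Function.Surjective (component φ V) :=
  (ModuleCat.epi_iff_surjective _).1 (inferInstanceAs (Epi (φ.app V)))

theorem component_injective {A B : SIMod.{u, v} k R} (φ : A ⟶ B) [Mono φ] (V : SI.{u} k) :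
    Function.Injective (component φ V) :=
  have := Abelian.hasPullbacks (C := ModuleCat.{max u v} R)
  (ModuleCat.mono_iff_injective _).1 (inferInstanceAs (Mono (φ.app V)))

theorem exists_component_eq {S : ShortComplex (SIMod.{u, v} k R)} (hS : S.Exact) (V : SI.{u} k)
    (x : S.X₂.obj V) (hx : component S.g V x = 0) : ∃ y, component S.f V y = x :=
  (ShortComplex.moduleCat_exact_iff _).1
    (hS.map ((evaluation (SI.{u} k) (ModuleCat.{max u v} R)).obj V)) x hx

theorem exists_mem_lower_component_eq {A B : SIMod.{u, v} k R} (φ : A ⟶ B) [Epi φ] {V : SI.{u} k}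
    {y : B.obj V} (hy : y ∈ lower B V) : ∃ x ∈ lower A V, component φ V x = y := by
  refine Submodule.span_induction ?_ ⟨0, zero_mem _, map_zero _⟩ ?_ ?_ hy
  · rintro _ ⟨W, f, b, hW, rfl⟩
    obtain ⟨a, rfl⟩ := component_surjective φ W b
    exact ⟨push A f a, push_mem_lower A f hW a, component_push φ f a⟩
  · rintro _ _ - - ⟨x, hx, rfl⟩ ⟨y, hy, rfl⟩
    exact ⟨x + y, add_mem hx hy, map_add _ _ _⟩
  · rintro c _ - ⟨x, hx, rfl⟩
    exact ⟨c • x, Submodule.smul_mem _ c hx, map_smul _ _ _⟩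

section ShortExact

variable {S : ShortComplex (SIMod.{u, v} k R)} [Projective S.X₂]

/-- The spliced resolution of `S.X₃` is the resolution of `S.X₁` moved up by one, so the two
vanishing criteria coincide. -/
theorem isZero_H_add_two_obj (hS : S.ShortExact) (n : ℕ) (V : SI.{u} k)
    (h : IsZero (((H k R (n + 1)).obj S.X₁).obj V)) :
    IsZero (((H k R (n + 2)).obj S.X₃).obj V) := by
  let Q := projectiveResolution S.X₁
  exact (isZero_H_succ_obj_iff (Q.splice hS) (n + 1) V).2 ((isZero_H_succ_obj_iff Q n V).1 h)

/-- Since `S.X₂` is projective, `H_1(S.X₃)` embeds in `H_0(S.X₁)`; here this is checked on elements.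
-/
theorem isZero_H_one_obj (hS : S.ShortExact) (V : SI.{u} k) (h : lower S.X₁ V = ⊤) :
    IsZero (((H k R 1).obj S.X₃).obj V) := by
  let Q := projectiveResolution S.X₁
  refine (isZero_H_succ_obj_iff (Q.splice hS) 0 V).2 fun (x : (Q.complex.X 0).obj V) _ => ?_
  let π : Q.complex.X 0 ⟶ S.X₁ := Q.π.f 0
  have : Epi π := inferInstanceAs (Epi (Q.π.f 0))
  obtain ⟨l, hl, e⟩ := exists_mem_lower_component_eq π (h ▸ Submodule.mem_top :
    component π V x ∈ lower S.X₁ V)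
  obtain ⟨y, hy⟩ := exists_component_eq Q.exact₀ V (x - l)
    ((map_sub (component π V) x l).trans (sub_eq_zero.2 e.symm))
  refine ⟨y, ?_⟩
  change x - component (Q.complex.d 1 0) V y ∈ lower (Q.complex.X 0) V
  have hy : component (Q.complex.d 1 0) V y = x - l := hy
  rwa [hy, sub_sub_cancel]

/-- In the long exact sequence `H_0(S.X₁)` sits between `H_1(S.X₃)` and `H_0(S.X₂)`, which both
vanish at `V`. -/
theorem lower_eq_top_of_isZero_H_one_obj (hS : S.ShortExact) (V : SI.{u} k)
    (h : IsZero (((H k R 1).obj S.X₃).obj V)) (h' : lower S.X₂ V = ⊤) : lower S.X₁ V = ⊤ := by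
  let Q := projectiveResolution S.X₁
  let π : Q.complex.X 0 ⟶ S.X₁ := Q.π.f 0
  have : Epi π := inferInstanceAs (Epi (Q.π.f 0))
  refine eq_top_iff.2 fun z _ => ?_
  obtain ⟨x, rfl⟩ := component_surjective π V z
  obtain ⟨y, hy⟩ := (isZero_H_succ_obj_iff (Q.splice hS) 0 V).1 h x
    (h' ▸ Submodule.mem_top : _ ∈ lower S.X₂ V)
  change (Q.complex.X 1).obj V at y
  have hy : x - component (Q.complex.d 1 0) V y ∈ lower (Q.complex.X 0) V := hy
  have h0 : component π V (component (Q.complex.d 1 0) V y) = 0 := by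
    refine (component_comp (Q.complex.d 1 0) π V y).symm.trans ?_
    rw [show Q.complex.d 1 0 ≫ π = 0 from Q.complex_d_comp_π_f_zero]
    rfl
  have := component_mem_lower π hy
  rwa [map_sub, h0, sub_zero] at this

end ShortExact

/-! ### Free modules as projective covers in bounded degrees -/

section Free

variable {J : Type} {X : J → SI.{u} k} {E : Type (max u v)} [AddCommGroup E] [Module R E]

/-- The generators of a free module. -/
noncomputable def freeSingle {V : SI.{u} k} (j : J) (f : X j ⟶ V) :
    E →ₗ[R] (free (R := R) X E).obj V := Finsupp.lsingle ⟨j, f⟩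

theorem push_freeSingle {V W : SI.{u} k} (j : J) (f : X j ⟶ V) (g : V ⟶ W) (e : E) :
    push (free (R := R) X E) g (freeSingle j f e) = freeSingle j (f ≫ g) e :=
  Finsupp.mapDomain_single

theorem freeSingle_eq_push {V : SI.{u} k} (j : J) (f : X j ⟶ V) (e : E) :
    freeSingle j f e = push (free (R := R) X E) f (freeSingle j (𝟙 _) e) := by
  rw [push_freeSingle, Category.id_comp]

theorem free_induction {V : SI.{u} k} (p : Submodule R ((free (R := R) X E).obj V))
    (h : ∀ (j : J) (f : X j ⟶ V) (e : E), freeSingle j f e ∈ p)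
    (x : (free (R := R) X E).obj V) : x ∈ p :=
  Finsupp.induction_linear (motive := fun x => x ∈ p) x (zero_mem p) (fun _ _ => add_mem)
    fun p e => h p.1 p.2 e

theorem free_linearMap_ext {V : SI.{u} k} {M : Type*} [AddCommGroup M] [Module R M]
    {α β : (free (R := R) X E).obj V →ₗ[R] M}
    (h : ∀ (j : J) (f : X j ⟶ V) (e : E), α (freeSingle j f e) = β (freeSingle j f e)) : α = β :=
  LinearMap.ext fun x => free_induction (LinearMap.eqLocus α β) h x

/-- The morphism from a free module that is given on generators. -/
noncomputable def freeDesc {A : SIMod.{u, v} k R} (a : ∀ j, E →ₗ[R] A.obj (X j)) :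
    free (R := R) X E ⟶ A where
  app V := ModuleCat.ofHom
    (Finsupp.lsum R fun p : Σ j, X j ⟶ V => push A p.2 ∘ₗ a p.1)
  naturality V W g := by
    refine ModuleCat.hom_ext (free_linearMap_ext fun j f e => ?_)
    have h1 : ∀ (V : SI.{u} k) (f : X j ⟶ V),
        (Finsupp.lsum R fun p : Σ j, X j ⟶ V => push A p.2 ∘ₗ a p.1)
          (Finsupp.single ⟨j, f⟩ e) = push A f (a j e) := fun V f => by simp
    change (Finsupp.lsum R fun p : Σ j, X j ⟶ W => push A p.2 ∘ₗ a p.1)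
      (push (free (R := R) X E) g (freeSingle j f e)) = push A g _
    rw [push_freeSingle]
    refine (h1 W (f ≫ g)).trans ((push_comp A f g _).trans ?_)
    exact congrArg (push A g) (h1 V f).symm

theorem component_freeDesc {A : SIMod.{u, v} k R} (a : ∀ j, E →ₗ[R] A.obj (X j)) {V : SI.{u} k}
    (j : J) (f : X j ⟶ V) (e : E) :
    component (freeDesc a) V (freeSingle j f e) = push A f (a j e) := by
  change (Finsupp.lsum R fun p : Σ j, X j ⟶ V => push A p.2 ∘ₗ a p.1)
    (Finsupp.single ⟨j, f⟩ e) = _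
  simp

theorem free_hom_ext {A : SIMod.{u, v} k R} {α β : free (R := R) X E ⟶ A}
    (h : ∀ j e, component α _ (freeSingle j (𝟙 _) e) = component β _ (freeSingle j (𝟙 _) e)) :
    α = β := by
  refine NatTrans.ext (funext fun V => ModuleCat.hom_ext (free_linearMap_ext fun j f e => ?_))
  change component α V _ = component β V _
  rw [freeSingle_eq_push, component_push, component_push, h]

/-- A morphism out of a free module amounts to a linear map on `E` for each `j`, and these are
lifted separately. -/
instance [Module.Projective R E] : Projective (free (R := R) X E) where
  factors {Z Y} f e _ := by
    have h (j : J) := Module.projective_lifting_property (component e (X j))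
      (component f (X j) ∘ₗ freeSingle j (𝟙 _)) (component_surjective e _)
    choose a ha using h
    refine ⟨freeDesc a, free_hom_ext fun j x => ?_⟩
    rw [component_comp, component_freeDesc, push_id]
    exact LinearMap.congr_fun (ha j) x

end Free

/-- The free module on the values of `A` in degrees `≤ N`. -/
noncomputable abbrev freeCover (A : SIMod.{u, v} k R) (N : ℕ) : SIMod.{u, v} k R :=
  free (fun m : Fin (N + 1) => SI.std k m) (∀ m : Fin (N + 1), A.obj (SI.std k m))

/-- The canonical morphism from the free module on the values of `A` in degrees `≤ N`. -/
noncomputable def freeCoverπ (A : SIMod.{u, v} k R) (N : ℕ) : freeCover A N ⟶ A :=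
  freeDesc fun m => LinearMap.proj m

theorem generatedInDegree_freeCover (A : SIMod.{u, v} k R) (N : ℕ) :
    GeneratedInDegree (freeCover A N) N := by
  intro V x
  refine free_induction (X := fun m : Fin (N + 1) => SI.std k m) _ (fun m f e => ?_) x
  exact Submodule.subset_span ⟨m, Nat.lt_succ_iff.1 m.2, f,
    freeSingle (X := fun m : Fin (N + 1) => SI.std k m) m (𝟙 _) e,
    (freeSingle_eq_push (X := fun m : Fin (N + 1) => SI.std k m) m f e).symm⟩

theorem GeneratedInDegree.epi_freeCoverπ {A : SIMod.{u, v} k R} {N : ℕ}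
    (hA : GeneratedInDegree A N) : Epi (freeCoverπ A N) := by
  have (V : SI.{u} k) : Epi ((freeCoverπ A N).app V) := by
    refine (ModuleCat.epi_iff_surjective _).2 fun x => ?_
    refine (Submodule.span_le (p := LinearMap.range (component (freeCoverπ A N) V))).2 ?_ (hA V x)
    rintro _ ⟨m, hm, f, a, rfl⟩
    let m' : Fin (N + 1) := ⟨m, Nat.lt_succ_iff.2 hm⟩
    have h : LinearMap.proj (R := R) (φ := fun m : Fin (N + 1) => A.obj (SI.std k m)) m'
        (Pi.single m' a) = a :=
      Pi.single_eq_same (M := fun m : Fin (N + 1) => A.obj (SI.std k m)) m' a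
    exact ⟨freeSingle (X := fun m : Fin (N + 1) => SI.std k m) m' f (Pi.single m' a),
      (component_freeDesc (X := fun m : Fin (N + 1) => SI.std k m) _ m' f _).trans
        (congrArg (push A f) h)⟩
  exact NatTrans.epi_of_epi_app _

/-- The short exact sequence `0 → K → F → A → 0` with `F` the free module on the values of `A` in
degrees `≤ N`. -/
noncomputable def coverSequence (A : SIMod.{u, v} k R) (N : ℕ) : ShortComplex (SIMod.{u, v} k R) :=
  ShortComplex.mk (kernel.ι (freeCoverπ A N)) (freeCoverπ A N) (kernel.condition _)

theorem GeneratedInDegree.shortExact_coverSequence {A : SIMod.{u, v} k R} {N : ℕ}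
    (hA : GeneratedInDegree A N) : (coverSequence A N).ShortExact where
  exact := ShortComplex.exact_kernel _
  mono_f := equalizer.ι_mono
  epi_g := hA.epi_freeCoverπ

theorem isZero_of_forall_lower_eq_top {A : SIMod.{u, v} k R}
    (h : ∀ n, lower A (SI.std k n) = ⊤) : IsZero A := by
  refine Functor.isZero _ fun V => ModuleCat.isZero_iff_subsingleton.2 ?_
  refine subsingleton_of_forall_eq 0 fun x => ?_
  have := span_eq_top_of_lower_eq_top (p := fun _ => False) (fun n _ => h n) V x
  simpa using this

end CommRing

/-! ### Iterating the kernel bound -/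

section Field

variable [Field R]

instance (A : SIMod.{u, v} k R) (N : ℕ) : Projective (coverSequence A N).X₂ :=
  inferInstanceAs (Projective (freeCover A N))

variable [Finite k] [CharZero R]

/-- As `j` is mono, the kernel of the cover of `K` is also the kernel of its composite with `j`, a
map to a free module. -/
theorem GeneratedInDegree.coverSequence_X₁ {J : Type} {X : J → SI.{u} k} {E : Type (max u v)}
    [AddCommGroup E] [Module R E] {K : SIMod.{u, v} k R} {N : ℕ} (hK : GeneratedInDegree K N)
    (j : K ⟶ free (R := R) X E) [Mono j] : GeneratedInDegree (coverSequence K N).X₁ (3 * N) := by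
  have hS := hK.shortExact_coverSequence
  refine (generatedInDegree_freeCover K N).kernel (coverSequence K N).f (freeCoverπ K N ≫ j)
    (fun V => @component_injective _ _ _ _ _ _ (coverSequence K N).f hS.mono_f V)
    (fun V x => ?_) fun V y hy => ?_
  · refine (congrArg (component j V) ?_).trans (map_zero _)
    refine (component_comp (coverSequence K N).f (coverSequence K N).g V x).symm.trans ?_
    rw [(coverSequence K N).zero]
    rfl
  · exact exists_component_eq hS.exact V y
      (component_injective j V (hy.trans (map_zero (component j V)).symm))

/-- Bound for the homology of a submodule of a free module. -/
theorem GeneratedInDegree.isZero_H_succ_obj {J : Type} {X : J → SI.{u} k} {E : Type (max u v)}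
    [AddCommGroup E] [Module R E] (i : ℕ) {K : SIMod.{u, v} k R} {N : ℕ}
    (hK : GeneratedInDegree K N) (j : K ⟶ free (R := R) X E) [Mono j] {n : ℕ}
    (hn : 3 ^ (i + 1) * N < n) : IsZero (((H k R (i + 1)).obj K).deg n) := by
  have hS := hK.shortExact_coverSequence
  have hK' := hK.coverSequence_X₁ j
  induction i generalizing K N J X E with
  | zero => exact isZero_H_one_obj hS _ (generatedInDegree_iff.1 hK' n (by simpa using hn))
  | succ i ih =>
    -- The kernel of the cover again lies in a free module, so the induction continues with `3 * N`
    -- in place of `N`.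
    let j' : (coverSequence K N).X₁ ⟶ freeCover K N := (coverSequence K N).f
    have : Mono j' := hS.mono_f
    exact isZero_H_add_two_obj hS _ _ (ih hK' j' (by rwa [← mul_assoc, ← pow_succ])
      hK'.shortExact_coverSequence (hK'.coverSequence_X₁ j'))

end Field

end SIMod

theorem theoremC (k : Type u) [Field k] [Finite k] (R : Type v) [Field R] [CharZero R]
    (A : SIMod.{u, v} k R) (d r : ℤ)
    (hd : ∀ n : ℕ, d < (n : ℤ) → IsZero (((SIMod.H0 k R).obj A).deg n))
    (hr : ∀ n : ℕ, r < (n : ℤ) → IsZero (((SIMod.H k R 1).obj A).deg n))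
    (i : ℕ) (hi : 2 ≤ i) (n : ℕ) (hn : 3 ^ (i - 1) * max r d < (n : ℤ)) :
    IsZero (((SIMod.H k R i).obj A).deg n) := by
  obtain ⟨i, rfl⟩ : ∃ i', i = i' + 2 := ⟨i - 2, by omega⟩
  have hd' : ∀ n : ℕ, d < (n : ℤ) → SIMod.lower A (SI.std k n) = ⊤ := fun n hn =>
    (SIMod.isZero_H0_obj_iff A _).1 (hd n hn)
  -- A negative bound leaves no room for generators, so `A = 0`; otherwise the bound is a natural
  -- number `N`.
  rcases lt_or_ge (max r d) 0 with hneg | hpos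
  · have hA : IsZero A := SIMod.isZero_of_forall_lower_eq_top fun n =>
      hd' n (by have := le_max_right r d; omega)
    have : Projective A := hA.projective
    exact ((SIMod.H0 k R).isZero_leftDerived_obj_projective_succ (i + 1) A).obj _
  · obtain ⟨N, hN⟩ := Int.eq_ofNat_of_zero_le hpos
    have hdN : ∀ n : ℕ, N < n → d < (n : ℤ) := fun n hn => by
      have := le_max_right r d; omega
    have hrN : ∀ n : ℕ, N < n → r < (n : ℤ) := fun n hn => by
      have := le_max_left r d; omega
    have hA : SIMod.GeneratedInDegree A N :=
      SIMod.generatedInDegree_iff.2 fun n hn => hd' n (hdN n hn)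
    have hS := hA.shortExact_coverSequence
    -- The bound on `H_1` keeps the first kernel in degrees `≤ N`. No factor 3 is lost here, hence
    -- the exponent `i - 1`.
    have hK : SIMod.GeneratedInDegree (SIMod.coverSequence A N).X₁ N :=
      SIMod.generatedInDegree_iff.2 fun n hn =>
        SIMod.lower_eq_top_of_isZero_H_one_obj hS _ (hr n (hrN n hn))
          (SIMod.generatedInDegree_iff.1 (SIMod.generatedInDegree_freeCover A N) n hn)
    let j : (SIMod.coverSequence A N).X₁ ⟶ SIMod.freeCover A N := (SIMod.coverSequence A N).f
    have : Mono j := hS.mono_f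
    refine SIMod.isZero_H_add_two_obj hS i _ (hK.isZero_H_succ_obj i j ?_)
    rw [hN] at hn
    exact_mod_cast hn
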